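/- For complex numbers $A,q$ put $(A)_0=1$ and $(A)_n=(1-A)(1-Aq)\cdots(1-Aq^{n-1})$ for $n\ge 1$; for integers $0\le n\le N$ let $$\begin{bmatrix}N\\ n\end{bmatrix}=\frac{(q)_N}{(q)_n(q)_{N-n}}$$ be the $q$-binomial coefficient, and let Fine's function be $$F(a,b;t)=\sum_{n=0}^{\infty}\frac{(aq)_n}{(bq)_n}\,t^n .$$ **Theorem.** Let $N$ be a nonnegative integer, and let $q,c\in\mathbb{C}$ satisfy $|q|<1$, $|cq|<1$ and $cq^{n}\neq 1$ for $0\le n\le N$. Then for each $1\le n\le N$ the series defining $F(q^N,q^n;cq^n)$ converges absolutely, and $$\frac{1}{(q)_N}\sum_{n=1}^{N}\begin{bmatrix}N\\ n\end{bmatrix}\frac{(-1)^{n-1}\,n\,q^{n(n+1)/2}}{1-cq^n}+\sum_{n=1}^{N}\begin{bmatrix}N\\ n\end{bmatrix}\frac{q^{n(n+1)}}{(q)_n(1-q^n)}\,F\left(q^N,q^n;cq^n\right)$$ $$=\frac{c}{(1-c)^2(q)_N}\left(\frac{(q)_N}{(cq)_N}-1\right)+\frac{1}{(c)_{N+1}}\sum_{n=1}^{N}\frac{(cq)_n}{(q)_n}\,\frac{q^n}{1-q^n}.$$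 -/

import Mathlib

noncomputable section

/-- The `q`-shifted factorial `(A; q)_n = (1 - A) (1 - A q) ⋯ (1 - A q ^ (n - 1))`,
with `(A; q)_0 = 1`. -/
def qShifted (A q : ℂ) (n : ℕ) : ℂ := ∏ k ∈ Finset.range n, (1 - A * q ^ k)

/-- The `q`-binomial coefficient `(q)_N / ((q)_n (q)_{N - n})` for `0 ≤ n ≤ N`, and `0` for
`n > N`. (For `‖q‖ < 1` the denominator never vanishes.) -/
def qBinom (q : ℂ) (N n : ℕ) : ℂ :=
  if n ≤ N then qShifted q q N / (qShifted q q n * qShifted q q (N - n)) else 0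

/-- The `n`-th term `(a q)_n / (b q)_n * t ^ n` of the series defining Fine's function. -/
def fineTerm (q a b t : ℂ) (n : ℕ) : ℂ :=
  qShifted (a * q) q n / qShifted (b * q) q n * t ^ n

/-- Fine's function `F(a, b; t) = ∑_{n ≥ 0} (a q)_n / (b q)_n * t ^ n` (with base `q`). -/
def fineF (q a b t : ℂ) : ℂ := ∑' n : ℕ, fineTerm q a b t n

end

/-! Expand the left side in powers of `c`: every series in it is geometric or Fine's, with ratio `c
* q ^ n` and `n ≥ 1`, so `‖c * q‖ < 1` suffices even when `‖c‖ ≥ 1`. The coefficient of `c ^ m` is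
`fineCoeff q (q ^ m) N` (`fineCoeff.eq_add`), which rests on `fineCoeff.div_succ` and a logarithmic
derivative of the finite q-binomial theorem.

A relation between `fineCoeff` at `X` and at `X * q` (`fineCoeff.mul_succ`) makes the generating
function `Φ_N` satisfy `(1 - c q^(N+1)) Φ_(N+1) = Φ_N + q^(N+1) / ((q)_(N+1) (1 - q^(N+1)))`. The
right side of the theorem obeys the same recursion, and both vanish at `N = 0`. -/

open Finset

/-! ### Shifted factorials -/

namespace qShifted

variable {q : ℂ}

theorem zero_right (A q : ℂ) : qShifted A q 0 = 1 := by simp [qShifted]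

theorem succ (A q : ℂ) (n : ℕ) :
    qShifted A q (n + 1) = qShifted A q n * (1 - A * q ^ n) := prod_range_succ _ _

theorem add (A q : ℂ) (m n : ℕ) :
    qShifted A q (m + n) = qShifted A q m * qShifted (A * q ^ m) q n := by
  simp only [qShifted, prod_range_add]
  congr 1
  exact prod_congr rfl fun k _ => by ring

theorem succ' (A q : ℂ) (n : ℕ) :
    qShifted A q (n + 1) = (1 - A) * qShifted (A * q) q n := by
  rw [add_comm, add, succ, zero_right]; simp

theorem one_sub_pow_ne_zero (hq : ‖q‖ < 1) (n : ℕ) : 1 - q ^ (n + 1) ≠ 0 := by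
  intro h
  have h1 : ‖q ^ (n + 1)‖ < 1 := by
    rw [norm_pow]; exact pow_lt_one₀ (norm_nonneg _) hq (Nat.succ_ne_zero n)
  rw [← sub_eq_zero.mp h] at h1
  simp at h1

theorem pow_mul_ne_zero (hq : ‖q‖ < 1) (m n : ℕ) : qShifted (q ^ m * q) q n ≠ 0 := by
  refine prod_ne_zero_iff.mpr fun k _ => ?_
  rw [← pow_succ, ← pow_add, add_right_comm]
  exact one_sub_pow_ne_zero hq _

theorem self_ne_zero (hq : ‖q‖ < 1) (n : ℕ) : qShifted q q n ≠ 0 := by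
  simpa using pow_mul_ne_zero hq 0 n

theorem self_succ (q : ℂ) (n : ℕ) :
    qShifted q q (n + 1) = qShifted q q n * (1 - q ^ (n + 1)) := by
  rw [succ, pow_succ']

/-- Both sides of `(q)_m (q ^ (m + 1))_n = (q)_n (q ^ (n + 1))_m` equal `(q)_{m + n}`. -/
theorem self_mul_comm (q : ℂ) (m n : ℕ) :
    qShifted q q m * qShifted (q ^ m * q) q n = qShifted q q n * qShifted (q ^ n * q) q m := by
  rw [mul_comm (q ^ m), mul_comm (q ^ n), ← add, ← add, add_comm]

theorem norm_le {A : ℂ} (hA : ‖A‖ ≤ 1) (hq : ‖q‖ ≤ 1) (n : ℕ) : ‖qShifted A q n‖ ≤ 2 ^ n := by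
  have h : ∀ k ∈ range n, ‖1 - A * q ^ k‖ ≤ 2 := fun k _ => by
    have h1 : ‖A * q ^ k‖ ≤ 1 := by
      rw [norm_mul, norm_pow]
      exact mul_le_one₀ hA (by positivity) (pow_le_one₀ (norm_nonneg _) hq)
    calc ‖1 - A * q ^ k‖ ≤ ‖(1 : ℂ)‖ + ‖A * q ^ k‖ := norm_sub_le _ _
      _ ≤ 2 := by rw [norm_one]; linarith
  simpa [qShifted, norm_prod] using prod_le_prod (fun _ _ => norm_nonneg _) h

end qShifted

/-! ### Gaussian binomials and finite q-series sums -/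

namespace qBinom

variable {q : ℂ}

theorem of_lt (q : ℂ) {N n : ℕ} (h : N < n) : qBinom q N n = 0 := by
  simp [qBinom, not_le.mpr h]

theorem zero_right (hq : ‖q‖ < 1) (N : ℕ) : qBinom q N 0 = 1 := by
  simp [qBinom, qShifted.zero_right, qShifted.self_ne_zero hq]

theorem self (hq : ‖q‖ < 1) (N : ℕ) : qBinom q N N = 1 := by
  simp [qBinom, qShifted.zero_right, qShifted.self_ne_zero hq]

theorem add_left (q : ℂ) (n k : ℕ) :
    qBinom q (n + k) n = qShifted q q (n + k) / (qShifted q q n * qShifted q q k) := by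
  simp [qBinom]

theorem succ_left_mul (hq : ‖q‖ < 1) (n k : ℕ) :
    qBinom q (n + k + 1) n * (1 - q ^ (k + 1)) = qBinom q (n + k) n * (1 - q ^ (n + k + 1)) := by
  have h3 := qShifted.one_sub_pow_ne_zero hq k
  rw [add_assoc, add_left, add_left, ← add_assoc, qShifted.self_succ, qShifted.self_succ]
  field_simp

theorem sub_mul (hq : ‖q‖ < 1) {N n : ℕ} (hn : n ≤ N + 1) :
    (qBinom q (N + 1) n - qBinom q N n) * (1 - q ^ (N + 1)) =
      q ^ (N + 1 - n) * (1 - q ^ n) * qBinom q (N + 1) n := by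
  rcases hn.eq_or_lt with rfl | hn
  · simp [self hq, of_lt q (Nat.lt_succ_self N)]
  · obtain ⟨k, rfl⟩ := Nat.exists_eq_add_of_le (Nat.lt_succ_iff.mp hn)
    rw [show n + k + 1 - n = k + 1 by omega]
    linear_combination succ_left_mul hq n k

theorem pascal (hq : ‖q‖ < 1) {N n : ℕ} (hn : n ≤ N) :
    qBinom q (N + 1) (n + 1) = qBinom q N (n + 1) + q ^ (N - n) * qBinom q N n := by
  have h0 := qShifted.one_sub_pow_ne_zero hq N
  have h1 := sub_mul hq (Nat.succ_le_succ hn)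
  have h2 : qBinom q (N + 1) (n + 1) * (1 - q ^ (n + 1)) = qBinom q N n * (1 - q ^ (N + 1)) := by
    obtain ⟨k, rfl⟩ := Nat.exists_eq_add_of_le hn
    have h5 := qShifted.one_sub_pow_ne_zero hq n
    rw [show n + k + 1 = n + 1 + k by omega, add_left, add_left,
      show n + 1 + k = n + k + 1 by omega, qShifted.self_succ, qShifted.self_succ]
    field_simp
  rw [show N.succ - n.succ = N - n by omega, Nat.succ_eq_add_one] at h1
  apply mul_right_cancel₀ h0
  linear_combination h1 + q ^ (N - n) * h2

theorem sum_succ (hq : ‖q‖ < 1) (N : ℕ) (f : ℕ → ℂ) :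
    ∑ n ∈ range (N + 2), qBinom q (N + 1) n * f n =
      ∑ n ∈ range (N + 1), qBinom q N n * f n +
        ∑ n ∈ range (N + 1), q ^ (N - n) * qBinom q N n * f (n + 1) := by
  have h : ∑ n ∈ range (N + 1), qBinom q N n * f n =
      ∑ n ∈ range (N + 2), qBinom q N n * f n := by
    rw [sum_range_succ _ (N + 1), of_lt q (Nat.lt_succ_self N)]; simp
  rw [h, sum_range_succ', sum_range_succ' _ (N + 1), zero_right hq, zero_right hq,
    add_right_comm, ← sum_add_distrib]
  congr 1
  refine sum_congr rfl fun n hn => ?_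
  rw [pascal hq (Nat.lt_succ_iff.mp (mem_range.mp hn))]
  ring

/-- After Pascal's rule the two terms at `n` share the factor `X^n (X)_(N-n)`, and the cofactors `1
- X q^(N-n)` and `X q^(N-n)` add to `1`. -/
theorem sum_pow_mul_qShifted (hq : ‖q‖ < 1) (X : ℂ) (N : ℕ) :
    ∑ n ∈ range (N + 1), qBinom q N n * (X ^ n * qShifted X q (N - n)) = 1 := by
  induction N with
  | zero => simp [zero_right hq, qShifted.zero_right]
  | succ N ih =>
    rw [sum_succ hq, ← sum_add_distrib, ← ih]
    refine sum_congr rfl fun n hn => ?_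
    have hn' := Nat.lt_succ_iff.mp (mem_range.mp hn)
    rw [Nat.succ_sub hn', qShifted.succ, show N + 1 - (n + 1) = N - n by omega]
    ring

/-- The finite form of Cauchy's Durfee square identity. -/
theorem sum_pow_div_qShifted (hq : ‖q‖ < 1) (N m : ℕ) :
    ∑ n ∈ range (N + 1), qBinom q N n * ((q ^ m) ^ n * q ^ (n * n) / qShifted (q ^ m * q) q n) =
      1 / qShifted (q ^ m * q) q N := by
  -- The shifted half of the Pascal split is, up to a factor, the same sum with `m + 1` in place of
  -- `m`.
  induction N generalizing m with
  | zero => simp [zero_right hq, qShifted.zero_right]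
  | succ N ih =>
    have h1 := qShifted.pow_mul_ne_zero hq m N
    have h2 : qShifted (q ^ m * q) q (N + 1) ≠ 0 := qShifted.pow_mul_ne_zero hq m (N + 1)
    have h3 : 1 - q ^ m * q ≠ 0 := by
      rw [← pow_succ]; exact qShifted.one_sub_pow_ne_zero hq m
    have key : ∑ n ∈ range (N + 1), q ^ (N - n) * qBinom q N n *
          ((q ^ m) ^ (n + 1) * q ^ ((n + 1) * (n + 1)) / qShifted (q ^ m * q) q (n + 1)) =
        q ^ m * q ^ (N + 1) / (1 - q ^ m * q) * (1 / qShifted (q ^ (m + 1) * q) q N) := by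
      rw [← ih (m + 1), mul_sum]
      refine sum_congr rfl fun n hn => ?_
      obtain ⟨k, rfl⟩ := Nat.exists_eq_add_of_le (Nat.lt_succ_iff.mp (mem_range.mp hn))
      rw [qShifted.succ', ← pow_succ q m, Nat.add_sub_cancel_left]
      rw [← pow_succ] at h3
      field_simp
      ring
    rw [sum_succ hq, ih, key]
    have h6 := qShifted.succ' (q ^ m * q) q N
    rw [← pow_succ q m] at h6 h3 h1 h2 ⊢
    have h7 := qShifted.succ (q ^ (m + 1)) q N
    have h8 : 1 - q ^ (m + 1) * q ^ N ≠ 0 := by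
      intro h; rw [h, mul_zero] at h7; exact h2 h7
    rw [div_mul_div_comm, mul_one, ← h6, h7]
    field_simp
    ring

theorem sum_neg_one_pow (hq : ‖q‖ < 1) (X : ℂ) (N : ℕ) :
    ∑ n ∈ range (N + 1), qBinom q N n * ((-1) ^ n * q ^ (n * (n + 1) / 2) * X ^ n) =
      qShifted (X * q) q N := by
  induction N with
  | zero => simp [zero_right hq, qShifted.zero_right]
  | succ N ih =>
    rw [sum_succ hq, qShifted.succ, ← ih, mul_sub, mul_one, sum_mul, sub_eq_add_neg,
      ← sum_neg_distrib]
    congr 1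
    refine sum_congr rfl fun n hn => ?_
    obtain ⟨k, rfl⟩ := Nat.exists_eq_add_of_le (Nat.lt_succ_iff.mp (mem_range.mp hn))
    rw [Nat.add_sub_cancel_left, show (n + 1) * (n + 1 + 1) / 2 = n * (n + 1) / 2 + (n + 1) by
      rw [show (n + 1) * (n + 1 + 1) = n * (n + 1) + (n + 1) * 2 by ring,
        Nat.add_mul_div_right _ _ two_pos]]
    ring

/-- The logarithmic derivative of the finite `q`-binomial theorem. -/
theorem sum_neg_one_pow_mul_nat (hq : ‖q‖ < 1) (m N : ℕ) :
    ∑ n ∈ range (N + 1),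
        qBinom q N n * ((-1) ^ (n - 1) * (n : ℂ) * q ^ (n * (n + 1) / 2) * (q ^ m) ^ n) =
      qShifted (q ^ m * q) q N *
        ∑ k ∈ range N, q ^ m * q ^ (k + 1) / (1 - q ^ m * q ^ (k + 1)) := by
  induction N with
  | zero => simp
  | succ N ih =>
    have h8 : 1 - q ^ m * q ^ (N + 1) ≠ 0 := by
      rw [← pow_add]; exact qShifted.one_sub_pow_ne_zero hq (m + N)
    have key : ∑ n ∈ range (N + 1), q ^ (N - n) * qBinom q N n *
          ((-1) ^ (n + 1 - 1) * ((n + 1 : ℕ) : ℂ) * q ^ ((n + 1) * (n + 1 + 1) / 2) *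
            (q ^ m) ^ (n + 1)) =
        q ^ m * q ^ (N + 1) * (qShifted (q ^ m * q) q N - qShifted (q ^ m * q) q N *
          ∑ k ∈ range N, q ^ m * q ^ (k + 1) / (1 - q ^ m * q ^ (k + 1))) := by
      rw [← ih, ← sum_neg_one_pow hq, ← sum_sub_distrib, mul_sum]
      refine sum_congr rfl fun n hn => ?_
      obtain ⟨k, rfl⟩ := Nat.exists_eq_add_of_le (Nat.lt_succ_iff.mp (mem_range.mp hn))
      rw [Nat.add_sub_cancel_left, show (n + 1) * (n + 1 + 1) / 2 = n * (n + 1) / 2 + (n + 1) by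
        rw [show (n + 1) * (n + 1 + 1) = n * (n + 1) + (n + 1) * 2 by ring,
          Nat.add_mul_div_right _ _ two_pos]]
      -- The truncated exponent `n - 1` is wrong only at `n = 0`, where the factor `n` kills the
      -- term.
      rcases n with _ | n
      · simp; ring
      · simp only [Nat.add_sub_cancel]
        push_cast
        ring
    rw [sum_succ hq, ih, key, sum_range_succ, qShifted.succ, mul_assoc (q ^ m) q, ← pow_succ']
    field_simp
    ring

end qBinom

/-! ### The coefficients in `c`; their `n = 0` terms are `0`, being divided by `1 - q ^ 0 = 0` -/

/-- The coefficient of `c ^ m` in `mainTheorem2`, for `X = q ^ m`. -/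
noncomputable def fineCoeff (q X : ℂ) (N : ℕ) : ℂ :=
  ∑ n ∈ range (N + 1), qBinom q N n * qShifted (X * q) q (N - n) / qShifted q q N *
    ((X * q) ^ n / (1 - q ^ n))

namespace fineCoeff

variable {q : ℂ}

theorem zero_right (q X : ℂ) : fineCoeff q X 0 = 0 := by simp [fineCoeff]

/-- Holds term by term: after cancelling common factors it is `qBinom.succ_left_mul`. With `X = q ^
m` it links consecutive `m`, giving the recursion in `N` for the generating function. -/
theorem mul_succ (hq : ‖q‖ < 1) (X : ℂ) (N : ℕ) :
    fineCoeff q (X * q) (N + 1) = q ^ (N + 1) * fineCoeff q X (N + 1) + fineCoeff q (X * q) N := by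
  have h : fineCoeff q (X * q) N =
      ∑ n ∈ range (N + 2), qBinom q N n * qShifted (X * q * q) q (N - n) / qShifted q q N *
        ((X * q * q) ^ n / (1 - q ^ n)) := by
    rw [sum_range_succ _ (N + 1), qBinom.of_lt q (Nat.lt_succ_self N)]; simp [fineCoeff]
  rw [h, fineCoeff, fineCoeff, mul_sum, ← sum_add_distrib]
  refine sum_congr rfl fun n hn => ?_
  have h1 := qShifted.self_ne_zero hq N
  have h2 := qShifted.one_sub_pow_ne_zero hq N
  rw [mul_pow (X * q) q n]
  rcases (Nat.lt_succ_iff.mp (mem_range.mp hn)).eq_or_lt with rfl | hn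
  · simp only [qBinom.self hq, qBinom.of_lt q (Nat.lt_succ_self N), Nat.sub_self,
      qShifted.zero_right]
    ring
  · obtain ⟨k, rfl⟩ := Nat.exists_eq_add_of_le (Nat.lt_succ_iff.mp hn)
    have h3 := qBinom.succ_left_mul hq n k
    rw [show n + k + 1 - n = k + 1 by omega, Nat.add_sub_cancel_left, qShifted.self_succ,
      qShifted.succ' (X * q), qShifted.succ (X * q * q)]
    have h4 : qBinom q (n + k + 1) n * (qShifted (X * q * q) q k * (1 - X * q * q * q ^ k)) /
          (qShifted q q (n + k) * (1 - q ^ (n + k + 1))) * q ^ n =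
        q ^ (n + k + 1) * (qBinom q (n + k + 1) n * ((1 - X * q) * qShifted (X * q * q) q k) /
          (qShifted q q (n + k) * (1 - q ^ (n + k + 1)))) +
        qBinom q (n + k) n * qShifted (X * q * q) q k / qShifted q q (n + k) * q ^ n := by
      generalize qShifted (X * q * q) q k = U
      field_simp
      linear_combination q ^ n * U * h3
    linear_combination ((X * q) ^ n / (1 - q ^ n)) * h4

/-- At `X = 1` the factors `(q)_(N-n)` and `(q)_N` cancel, so `fineCoeff` is a partial sum of a
series not depending on `N`. -/
theorem one_succ (hq : ‖q‖ < 1) (N : ℕ) :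
    fineCoeff q 1 (N + 1) =
      fineCoeff q 1 N + q ^ (N + 1) / (qShifted q q (N + 1) * (1 - q ^ (N + 1))) := by
  have h : ∀ M, fineCoeff q 1 M =
      ∑ n ∈ range (M + 1), q ^ n / (qShifted q q n * (1 - q ^ n)) := fun M => by
    refine sum_congr rfl fun n hn => ?_
    obtain ⟨k, rfl⟩ := Nat.exists_eq_add_of_le (Nat.lt_succ_iff.mp (mem_range.mp hn))
    have h2 := qShifted.self_ne_zero hq k
    have h3 := qShifted.self_ne_zero hq (n + k)
    rw [qBinom.add_left, one_mul, Nat.add_sub_cancel_left]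
    field_simp
  rw [h, h, sum_range_succ]

/-- Both sides vanish at `N = 0`. Their increments in `N` lose the denominator `1 - q ^ n`, so known
sums evaluate them: the Durfee identity in `B`, `sum_pow_mul_qShifted` in `C`. -/
theorem div_succ (hq : ‖q‖ < 1) (m N : ℕ) :
    (∑ n ∈ range (N + 1), qBinom q N n *
      (qShifted (q ^ m * q) q (N - n) / qShifted (q ^ m * q) q N *
        ((q ^ m * q) ^ n / (1 - q ^ n)))) =
    ∑ k ∈ range N, q ^ m * q ^ (k + 1) / (1 - q ^ m * q ^ (k + 1)) +
      ∑ n ∈ range (N + 1), qBinom q N n *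
        ((q ^ m) ^ n * q ^ (n * (n + 1)) / (qShifted (q ^ m * q) q n * (1 - q ^ n))) := by
  induction N with
  | zero => simp
  | succ N ih =>
    have h0 := qShifted.one_sub_pow_ne_zero hq N
    have h1 : 1 - q ^ m * q ^ (N + 1) ≠ 0 := by
      rw [← pow_add]; exact qShifted.one_sub_pow_ne_zero hq (m + N)
    have h2 := qShifted.pow_mul_ne_zero hq m N
    have ext0 : ∀ f : ℕ → ℂ, ∑ n ∈ range (N + 1), qBinom q N n * f n =
        ∑ n ∈ range (N + 2), qBinom q N n * f n := fun f => by
      rw [sum_range_succ _ (N + 1), qBinom.of_lt q (Nat.lt_succ_self N)]; simp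
    have B : (∑ n ∈ range (N + 2), qBinom q (N + 1) n *
          ((q ^ m) ^ n * q ^ (n * (n + 1)) / (qShifted (q ^ m * q) q n * (1 - q ^ n)))) -
        ∑ n ∈ range (N + 1), qBinom q N n *
          ((q ^ m) ^ n * q ^ (n * (n + 1)) / (qShifted (q ^ m * q) q n * (1 - q ^ n))) =
        q ^ (N + 1) / (1 - q ^ (N + 1)) * (1 / qShifted (q ^ m * q) q (N + 1) - 1) := by
      rw [ext0, ← sum_sub_distrib, ← qBinom.sum_pow_div_qShifted hq, sum_range_succ',
        sum_range_succ' _ (N + 1), qBinom.zero_right hq (N + 1), qShifted.zero_right]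
      simp only [pow_zero, sub_self, mul_zero, div_zero, add_zero, zero_mul, mul_one, div_one,
        add_sub_cancel_right, mul_sum]
      refine sum_congr rfl fun n hn => ?_
      have h3 := qShifted.one_sub_pow_ne_zero hq n
      have h5 := qBinom.sub_mul hq (Nat.succ_le_succ (Nat.lt_succ_iff.mp (mem_range.mp hn)))
      obtain ⟨k, rfl⟩ := Nat.exists_eq_add_of_le (Nat.lt_succ_iff.mp (mem_range.mp hn))
      rw [show n + k + 1 - n.succ = k by omega] at h5
      rw [← sub_mul, eq_div_of_mul_eq h0 h5]
      simp only [Nat.succ_eq_add_one]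
      field_simp
      ring
    have C : (∑ n ∈ range (N + 2), qBinom q (N + 1) n *
          (qShifted (q ^ m * q) q (N + 1 - n) / qShifted (q ^ m * q) q (N + 1) *
            ((q ^ m * q) ^ n / (1 - q ^ n)))) -
        ∑ n ∈ range (N + 1), qBinom q N n *
          (qShifted (q ^ m * q) q (N - n) / qShifted (q ^ m * q) q N *
            ((q ^ m * q) ^ n / (1 - q ^ n))) =
        q ^ (N + 1) / (1 - q ^ (N + 1)) / qShifted (q ^ m * q) q (N + 1) *
          (1 - qShifted (q ^ m) q (N + 1)) := by
      have h6 := qBinom.sum_pow_mul_qShifted hq (q ^ m) (N + 1)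
      rw [sum_range_succ', qBinom.zero_right hq (N + 1), pow_zero, one_mul, one_mul,
        Nat.sub_zero] at h6
      rw [ext0, ← sum_sub_distrib, ← eq_sub_of_add_eq h6, sum_range_succ']
      simp only [pow_zero, sub_self, mul_zero, div_zero, add_zero, mul_sum]
      refine sum_congr rfl fun n hn => ?_
      have h3 := qShifted.one_sub_pow_ne_zero hq n
      have h7 := qShifted.succ (q ^ m * q) q N
      rw [mul_assoc (q ^ m) q, ← pow_succ'] at h7
      rcases (Nat.lt_succ_iff.mp (mem_range.mp hn)).eq_or_lt with rfl | hn
      · simp only [qBinom.self hq, qBinom.of_lt q (Nat.lt_succ_self n), Nat.sub_self,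
          qShifted.zero_right]
        field_simp
        ring
      · obtain ⟨k, rfl⟩ := Nat.exists_eq_add_of_lt hn
        have h5 := qBinom.succ_left_mul hq (n + 1) k
        rw [show n + k + 1 + 1 - (n + 1) = k + 1 by omega, show n + k + 1 - (n + 1) = k by omega,
          h7, qShifted.succ' (q ^ m), qShifted.succ]
        rw [show n + 1 + k + 1 = n + k + 1 + 1 by omega, show n + 1 + k = n + k + 1 by omega] at h5
        have h8 := eq_div_of_mul_eq h0 h5.symm
        rw [h8]
        field_simp
        ring
    have h7 := qShifted.succ (q ^ m * q) q N
    rw [mul_assoc (q ^ m) q, ← pow_succ'] at h7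
    have h9 := qShifted.succ' (q ^ m) q N
    rw [eq_add_of_sub_eq C, eq_add_of_sub_eq B, ih,
      sum_range_succ (fun k => q ^ m * q ^ (k + 1) / (1 - q ^ m * q ^ (k + 1))), h7, h9]
    generalize (∑ k ∈ range N, q ^ m * q ^ (k + 1) / (1 - q ^ m * q ^ (k + 1))) = S
    generalize (∑ n ∈ range (N + 1), qBinom q N n * _) = T
    generalize qShifted (q ^ m * q) q N = U at h2 ⊢
    generalize q ^ (N + 1) = Q at h0 h1 ⊢
    generalize q ^ m = M at h1 ⊢
    rw [mul_comm M] at h1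
    field_simp
    ring

theorem eq_add (hq : ‖q‖ < 1) (m N : ℕ) :
    fineCoeff q (q ^ m) N =
      1 / qShifted q q N * (∑ n ∈ range (N + 1), qBinom q N n *
        ((-1) ^ (n - 1) * (n : ℂ) * q ^ (n * (n + 1) / 2) * (q ^ m) ^ n)) +
      ∑ n ∈ range (N + 1), qBinom q N n * (q ^ (n * (n + 1)) / (qShifted q q n * (1 - q ^ n))) *
        (qShifted (q ^ N * q) q m / qShifted (q ^ n * q) q m * (q ^ n) ^ m) := by
  have h1 := qShifted.self_ne_zero hq N
  have h2 := qShifted.pow_mul_ne_zero hq m N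
  have h : fineCoeff q (q ^ m) N = qShifted (q ^ m * q) q N / qShifted q q N *
      ∑ n ∈ range (N + 1), qBinom q N n *
        (qShifted (q ^ m * q) q (N - n) / qShifted (q ^ m * q) q N *
          ((q ^ m * q) ^ n / (1 - q ^ n))) := by
    rw [mul_sum]
    refine sum_congr rfl fun n _ => ?_
    field_simp
  rw [h, div_succ hq, qBinom.sum_neg_one_pow_mul_nat hq, mul_add]
  congr 1
  · ring
  · rw [mul_sum]
    refine sum_congr rfl fun n _ => ?_
    have h3 := qShifted.self_ne_zero hq n
    have h6 := qShifted.self_ne_zero hq m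
    -- Swapping the roles of base and length turns Fine's factors of length `m` into factors of
    -- lengths `N` and `n`, matching `div_succ`.
    have h7 : qShifted (q ^ N * q) q m =
        qShifted q q m * qShifted (q ^ m * q) q N / qShifted q q N :=
      eq_div_of_mul_eq h1 (by rw [qShifted.self_mul_comm, mul_comm])
    have h8 : qShifted (q ^ n * q) q m =
        qShifted q q m * qShifted (q ^ m * q) q n / qShifted q q n :=
      eq_div_of_mul_eq h3 (by rw [qShifted.self_mul_comm, mul_comm])
    rw [h7, h8, ← pow_mul, ← pow_mul, mul_comm n m]
    field_simp

end fineCoeff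

/-! ### Convergence, generating function and recursion in `N` -/

theorem norm_mul_pow_lt_one {q c : ℂ} (hq : ‖q‖ < 1) (hcq : ‖c * q‖ < 1) {n : ℕ} (hn : 1 ≤ n) :
    ‖c * q ^ n‖ < 1 := by
  obtain ⟨k, rfl⟩ := Nat.exists_eq_add_of_le hn
  rw [pow_add, pow_one, ← mul_assoc, norm_mul, norm_pow]
  exact mul_lt_one_of_nonneg_of_lt_one_left (norm_nonneg _) hcq
    (pow_le_one₀ (norm_nonneg _) hq.le)

/-- Since `n ≤ N`, the quotient of shifted factorials is a constant times a product of `N - n`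
factors of norm at most `2`, so a geometric series dominates. -/
theorem summable_fineTerm {q t : ℂ} (hq : ‖q‖ < 1) (ht : ‖t‖ < 1) {n N : ℕ} (hn : n ≤ N) :
    Summable (fineTerm q (q ^ N) (q ^ n) t) := by
  obtain ⟨k, rfl⟩ := Nat.exists_eq_add_of_le hn
  have h1 := qShifted.self_ne_zero hq n
  have h2 := qShifted.self_ne_zero hq (n + k)
  refine Summable.of_norm_bounded
    (g := fun m => ‖qShifted q q n / qShifted q q (n + k)‖ * 2 ^ k * ‖t‖ ^ m)
    ((summable_geometric_of_lt_one (norm_nonneg _) ht).mul_left _) fun m => ?_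
  have h4 := qShifted.pow_mul_ne_zero hq m n
  have h6 := qShifted.self_ne_zero hq m
  have h7 : qShifted (q ^ (n + k) * q) q m = qShifted q q m *
      (qShifted (q ^ m * q) q n * qShifted (q ^ m * q * q ^ n) q k) / qShifted q q (n + k) :=
    eq_div_of_mul_eq h2 (by rw [← qShifted.add, qShifted.self_mul_comm, mul_comm])
  have h8 : qShifted (q ^ n * q) q m =
      qShifted q q m * qShifted (q ^ m * q) q n / qShifted q q n :=
    eq_div_of_mul_eq h1 (by rw [qShifted.self_mul_comm, mul_comm])
  have h9 : fineTerm q (q ^ (n + k)) (q ^ n) t m =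
      qShifted q q n / qShifted q q (n + k) * qShifted (q ^ m * q * q ^ n) q k * t ^ m := by
    rw [fineTerm, h7, h8]
    field_simp
  rw [h9, norm_mul, norm_mul, norm_pow]
  gcongr
  refine qShifted.norm_le ?_ hq.le k
  rw [← pow_succ, ← pow_add, norm_pow]
  exact pow_le_one₀ (norm_nonneg _) hq.le

theorem sum_Icc_eq_sum_range_of_zero {f : ℕ → ℂ} (hf : f 0 = 0) (N : ℕ) :
    ∑ n ∈ Icc 1 N, f n = ∑ n ∈ range (N + 1), f n := by
  rw [sum_range_succ', hf, add_zero, ← Finset.Ico_add_one_right_eq_Icc, sum_Ico_eq_sum_range]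
  exact sum_congr (by simp) fun n _ => by rw [add_comm]

/-- The left-hand side of `mainTheorem2` is the generating function of `fineCoeff`. -/
theorem hasSum_fineCoeff {q c : ℂ} (hq : ‖q‖ < 1) (hcq : ‖c * q‖ < 1) (N : ℕ) :
    HasSum (fun m : ℕ => fineCoeff q (q ^ m) N * c ^ m)
      (1 / qShifted q q N *
          (∑ n ∈ Icc 1 N,
            qBinom q N n * ((-1) ^ (n - 1) * (n : ℂ) * q ^ (n * (n + 1) / 2) / (1 - c * q ^ n)))
        + ∑ n ∈ Icc 1 N,
            qBinom q N n * (q ^ (n * (n + 1)) / (qShifted q q n * (1 - q ^ n))) *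
              fineF q (q ^ N) (q ^ n) (c * q ^ n)) := by
  have h1 := (hasSum_sum (s := Icc 1 N) fun n hn =>
    ((hasSum_geometric_of_norm_lt_one
      (norm_mul_pow_lt_one hq hcq (mem_Icc.mp hn).1)).mul_left
      ((-1) ^ (n - 1) * (n : ℂ) * q ^ (n * (n + 1) / 2))).mul_left
        (qBinom q N n)).mul_left (1 / qShifted q q N)
  have h2 := hasSum_sum (s := Icc 1 N) fun n hn =>
    (summable_fineTerm hq (norm_mul_pow_lt_one hq hcq (mem_Icc.mp hn).1)
      (mem_Icc.mp hn).2).hasSum.mul_left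
        (qBinom q N n * (q ^ (n * (n + 1)) / (qShifted q q n * (1 - q ^ n))))
  convert! h1.add h2 using 1
  funext m
  rw [fineCoeff.eq_add hq, sum_Icc_eq_sum_range_of_zero (by simp),
    sum_Icc_eq_sum_range_of_zero (by simp), add_mul, mul_assoc, sum_mul, sum_mul]
  congr 1
  · congr 1
    refine sum_congr rfl fun n _ => ?_
    ring
  · refine sum_congr rfl fun n _ => ?_
    rw [fineTerm]
    ring

theorem tsum_fineCoeff_succ {q c : ℂ} (hq : ‖q‖ < 1) (hcq : ‖c * q‖ < 1) (N : ℕ) :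
    (∑' m : ℕ, fineCoeff q (q ^ m) (N + 1) * c ^ m) * (1 - c * q ^ (N + 1)) =
      ∑' m : ℕ, fineCoeff q (q ^ m) N * c ^ m +
        q ^ (N + 1) / (qShifted q q (N + 1) * (1 - q ^ (N + 1))) := by
  have s0 := (hasSum_fineCoeff hq hcq N).summable
  have s1 := (hasSum_fineCoeff hq hcq (N + 1)).summable
  -- `mul_succ` reaches only the terms with `m ≥ 1`; the `m = 0` terms are compared by `one_succ`.
  have h : ∑' m : ℕ, fineCoeff q (q ^ (m + 1)) (N + 1) * c ^ (m + 1) =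
      c * q ^ (N + 1) * ∑' m : ℕ, fineCoeff q (q ^ m) (N + 1) * c ^ m +
        ∑' m : ℕ, fineCoeff q (q ^ (m + 1)) N * c ^ (m + 1) := by
    rw [← tsum_mul_left, ← (s1.mul_left _).tsum_add ((summable_nat_add_iff 1).mpr s0)]
    refine tsum_congr fun m => ?_
    rw [pow_succ q m, fineCoeff.mul_succ hq]
    ring
  have e0 := s0.tsum_eq_zero_add
  have e1 := s1.tsum_eq_zero_add
  simp only [pow_zero, mul_one] at e0 e1
  have := fineCoeff.one_succ hq N
  linear_combination e1 - e0 + h + this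

theorem tsum_fineCoeff {q c : ℂ} (hq : ‖q‖ < 1) (hcq : ‖c * q‖ < 1) (N : ℕ)
    (hc : ∀ n : ℕ, n ≤ N → c * q ^ n ≠ 1) :
    ∑' m : ℕ, fineCoeff q (q ^ m) N * c ^ m =
      c / ((1 - c) ^ 2 * qShifted q q N) * (qShifted q q N / qShifted (c * q) q N - 1)
        + 1 / qShifted c q (N + 1) *
            ∑ n ∈ Icc 1 N,
              qShifted (c * q) q n / qShifted q q n * (q ^ n / (1 - q ^ n)) := by
  induction N with
  | zero => simp [fineCoeff.zero_right, qShifted.zero_right]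
  | succ N ih =>
    have h0 : 1 - c ≠ 0 := sub_ne_zero.mpr fun h => hc 0 (Nat.zero_le _) (by simp [← h])
    have h1 : 1 - c * q ^ (N + 1) ≠ 0 := sub_ne_zero.mpr (hc (N + 1) le_rfl).symm
    have h2 : qShifted (c * q) q N ≠ 0 := prod_ne_zero_iff.mpr fun k hk => by
      rw [mul_assoc, ← pow_succ']
      exact sub_ne_zero.mpr (hc (k + 1) (by have := mem_range.mp hk; omega)).symm
    have h4 := qShifted.one_sub_pow_ne_zero hq N
    apply mul_right_cancel₀ h1
    rw [tsum_fineCoeff_succ hq hcq, ih fun n hn => hc n (hn.trans N.le_succ),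
      sum_Icc_succ_top (Nat.le_add_left 1 N), qShifted.succ' c q (N + 1), qShifted.succ' c q N,
      qShifted.self_succ, qShifted.succ (c * q), mul_assoc c q, ← pow_succ']
    field_simp
    ring

theorem mainTheorem2 (N : ℕ) (q c : ℂ) (hq : ‖q‖ < 1) (hcq : ‖c * q‖ < 1)
    (hc : ∀ n : ℕ, n ≤ N → c * q ^ n ≠ 1) :
    (∀ n ∈ Finset.Icc 1 N, Summable (fineTerm q (q ^ N) (q ^ n) (c * q ^ n))) ∧
    1 / qShifted q q N *
          (∑ n ∈ Finset.Icc 1 N,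
            qBinom q N n * ((-1) ^ (n - 1) * (n : ℂ) * q ^ (n * (n + 1) / 2) / (1 - c * q ^ n)))
        + ∑ n ∈ Finset.Icc 1 N,
            qBinom q N n * (q ^ (n * (n + 1)) / (qShifted q q n * (1 - q ^ n))) *
              fineF q (q ^ N) (q ^ n) (c * q ^ n)
      = c / ((1 - c) ^ 2 * qShifted q q N) * (qShifted q q N / qShifted (c * q) q N - 1)
        + 1 / qShifted c q (N + 1) *
            ∑ n ∈ Finset.Icc 1 N,
              qShifted (c * q) q n / qShifted q q n * (q ^ n / (1 - q ^ n)) := by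
  refine ⟨fun n hn => summable_fineTerm hq (norm_mul_pow_lt_one hq hcq (mem_Icc.mp hn).1)
    (mem_Icc.mp hn).2, ?_⟩
  rw [← tsum_fineCoeff hq hcq N hc]
  exact (hasSum_fineCoeff hq hcq N).tsum_eq.symm
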